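/- Let $e\in\mathbb{R}^n$ be the all-ones vector, $\overline E=\{c\,e: c\in\mathbb{R}\}$, let $\|\cdot\|_{\mathcal P}$ be a semi-norm on $\mathbb{R}^n$ whose kernel is exactly $\overline E$, and let $\gamma\in(0,1)$. **Setup.** For a norm $\|\cdot\|$ put $\|x\|_{\overline E}:=\inf_{c\in\mathbb{R}}\|x-c\,e\|$. Call $(\|\cdot\|_{\mathcal N},\|\cdot\|_s,\theta,\sigma)$ an admissible smoothing if $\|\cdot\|_{\mathcal N}$ and $\|\cdot\|_s$ are norms on $\mathbb{R}^n$ with $\|x\|_{\mathcal N,\overline E}=\|x\|_{\mathcal P}$ for all $x$, $\theta,\sigma>0$, and $\tfrac12\|\cdot\|_s^2$ is $\sigma$-smooth with respect to $\|\cdot\|_s$. (A function $f$ is $L$-smooth with respect to a semi-norm $q$ if it is differentiable and $f(y)\le f(x)+\langle\nabla f(x),y-x\rangle+\tfrac L2 q(y-x)^2$ for all $x,y$.) Its semi-Lyapunov function is $M_{\overline E}(x):=\inf_{c\in\mathbb{R}}\inf_{u}\{\tfrac12\|u\|_{\mathcal N}^2+\tfrac1{2\theta}\|x-c\,e-u\|_s^2\}$.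 Call $c_l,c_u,L,\rho_2>0$ constants of the smoothing if $c_lM_{\overline E}(x)\le\tfrac12\|x\|_{\mathcal P}^2\le c_uM_{\overline E}(x)$ and $\|x\|_{s,\overline E}\le\rho_2\|x\|_{\mathcal P}$ for all $x$, and $M_{\overline E}$ is $L$-smooth with respect to $\|\cdot\|_{s,\overline E}$. Put $\alpha_2:=1-\gamma\sqrt{c_u/c_l}$. **Theorem.** (i) Every admissible smoothing has constants $c_l,c_u,L,\rho_2$, with $L=\sigma/\theta$. (ii) There is an admissible smoothing with constants for which $\alpha_2\ge(1-\gamma)/2$. (iii) Consider any admissible smoothing with constants such that $\alpha_2>0$. Let $H:\mathbb{R}^n\to\mathbb{R}^n$ satisfy $\|H(x)-H(y)\|_{\mathcal P}\le\gamma\|x-y\|_{\mathcal P}$ for all $x,y$, let $H(x^*)-x^*\in\overline E$, and let $A,B\ge0$. Put $$\alpha_3:=(8+2B)c_u\rho_2^2L,\qquad \alpha_4:=A\rho_2^2L,\qquad K:=\max\{\alpha_3/\alpha_2^2,\,3\},\qquad \eta_t:=\frac{1}{\alpha_2(t+K)}.$$ Let $x^0$ be deterministic and $x^{t+1}=x^t+\eta_t\,(H(x^t)+w^t-x^t)$,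 where $x^t$ is adapted to a filtration $(\mathcal F^t)$ on a probability space, $w^t$ and $\|w^t\|_{\mathcal P}^2$ are integrable, and almost surely, for every $t$, $$\mathbb{E}[\|w^t\|_{\mathcal P}^2\mid\mathcal F^t]\le A+B\|x^t-x^*\|_{\mathcal P}^2,\qquad \|\mathbb{E}[w^t\mid\mathcal F^t]\|_{\mathcal P}\le\varepsilon_{\rm bias}.$$ If $\varepsilon_{\rm bias}\neq0$, let $x_{\sup}$ be a number with $\|x^*\|_{\mathcal P}\le x_{\sup}$ and, for all $t$, $\|x^t\|_{\mathcal P}\le x_{\sup}$ almost surely (if $\varepsilon_{\rm bias}=0$, no boundedness is needed and the last term below is $0$). Then for every $T\ge1$ the variable $\|x^T-x^*\|_{\mathcal P}^2$ is integrable and $$\mathbb{E}\|x^T-x^*\|_{\mathcal P}^2\le\frac{4K^2c_u}{(T+K)^2c_l}\|x^0-x^*\|_{\mathcal P}^2+\frac{8\,\alpha_4c_u}{(T+K)\,\alpha_2^2}+\frac{2c_u\,C_1C_2\,\varepsilon_{\rm bias}}{\alpha_2},$$ where $C_1=2G\,x_{\sup}$, $G=\rho_2^2L$ and $C_2=\frac1K+\log\frac{T-1+K}{K}$.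 By (ii) one may take $1/\alpha_2\le2/(1-\gamma)$, so with $c_u,c_l,L,\rho_2,K$ absorbed in the constants the bound reads $O(1/T^2)\|x^0-x^*\|_{\mathcal P}^2+O\big(\tfrac{A}{(1-\gamma)^2T}\big)+O\big(\tfrac{x_{\sup}\,\varepsilon_{\rm bias}\log T}{1-\gamma}\big)$. -/

import Mathlib

open MeasureTheory

namespace BiasedSA

noncomputable section

variable {ι : Type*} [Fintype ι]

/-- The function on `ℝ^ι` induced by `N` and the line of constant vectors:
`‖x‖_{N,E} = inf_c N (x - c e)`, with `e` the all-ones vector (the constant function `1`). -/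
def quot (N : Seminorm ℝ (ι → ℝ)) (x : ι → ℝ) : ℝ :=
  ⨅ c : ℝ, N (x - c • (1 : ι → ℝ))

/-- Generalized Moreau envelope of `½ N²` with respect to `½ s²`, with parameter `θ`:
`M x = inf_u (½ N(u)² + (1/θ) ½ s(x - u)²)`. -/
def moreau (N s : Seminorm ℝ (ι → ℝ)) (θ : ℝ) (x : ι → ℝ) : ℝ :=
  ⨅ u : ι → ℝ, (1 / 2 * N u ^ 2 + 1 / θ * (1 / 2 * s (x - u) ^ 2))

/-- The semi-Lyapunov function `M_E`: infimal convolution of the Moreau envelope with the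
indicator function of the line of constant vectors. -/
def lyap (N s : Seminorm ℝ (ι → ℝ)) (θ : ℝ) (x : ι → ℝ) : ℝ :=
  ⨅ c : ℝ, moreau N s θ (x - c • (1 : ι → ℝ))

/-- `f` is `L`-smooth with respect to the (semi-)norm `q`. -/
def IsSmoothWrt (f : (ι → ℝ) → ℝ) (L : ℝ) (q : (ι → ℝ) → ℝ) : Prop :=
  Differentiable ℝ f ∧
    ∀ x y, f y ≤ f x + fderiv ℝ f x (y - x) + L / 2 * q (y - x) ^ 2

/-- Admissible ingredients of the semi-Lyapunov function for the semi-norm `p`: a norm `N` that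
induces `p` modulo constant vectors, a norm `s` whose half square is `σ`-smooth with respect to
`s`, and a parameter `θ > 0`. -/
structure IsSmoothing (p N s : Seminorm ℝ (ι → ℝ)) (θ σ : ℝ) : Prop where
  norm_N : ∀ x, N x = 0 → x = 0
  quot_N : ∀ x, quot N x = p x
  norm_s : ∀ x, s x = 0 → x = 0
  theta_pos : 0 < θ
  sigma_pos : 0 < σ
  smooth_s : IsSmoothWrt (fun x => 1 / 2 * s x ^ 2) σ s

/-- `cl`, `cu` are comparison constants between the semi-Lyapunov function `M_E` and `½ p²`, `L` is
a smoothness constant of `M_E` with respect to the semi-norm `‖·‖_{s,E}`, and `ρ` is a comparison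
constant `‖·‖_{s,E} ≤ ρ p`. -/
structure IsConstants (p N s : Seminorm ℝ (ι → ℝ)) (θ cl cu L ρ : ℝ) : Prop where
  cl_pos : 0 < cl
  cu_pos : 0 < cu
  L_pos : 0 < L
  rho_pos : 0 < ρ
  lower : ∀ x, cl * lyap N s θ x ≤ 1 / 2 * p x ^ 2
  upper : ∀ x, 1 / 2 * p x ^ 2 ≤ cu * lyap N s θ x
  smooth : IsSmoothWrt (lyap N s θ) L (quot s)
  quot_le : ∀ x, quot s x ≤ ρ * p x

/-- The drift constant `α₂ = 1 - γ √(c_u / c_l)`. -/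
def alpha2 (γ cl cu : ℝ) : ℝ := 1 - γ * Real.sqrt (cu / cl)

/-- The constant `α₃ = (8 + 2B) c_u ρ² L`. -/
def alpha3 (B cu L ρ : ℝ) : ℝ := (8 + 2 * B) * cu * ρ ^ 2 * L

/-- The constant `α₄ = A ρ² L`. -/
def alpha4 (A L ρ : ℝ) : ℝ := A * ρ ^ 2 * L

/-- The step-size offset `K = max {α₃ / α₂², 3}`. -/
def offset (γ B cl cu L ρ : ℝ) : ℝ :=
  max (alpha3 B cu L ρ / alpha2 γ cl cu ^ 2) 3

/-- `x` is generated by the stochastic approximation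
`x^{t+1} = x^t + η_t (H(x^t) + w^t - x^t)` from the deterministic point `x0`, is adapted to `ℱ`,
and the noise `w` has, given `ℱ t`, second moment at most `A + B p(x^t - x*)²` and bias at
most `ε`. -/
structure IsBiasedSA {Ω : Type*} [mΩ : MeasurableSpace Ω] (μ : Measure Ω) (ℱ : Filtration ℕ mΩ)
    (p : Seminorm ℝ (ι → ℝ)) (H : (ι → ℝ) → (ι → ℝ)) (xstar x0 : ι → ℝ) (η : ℕ → ℝ)
    (A B ε : ℝ) (x w : ℕ → Ω → (ι → ℝ)) : Prop where
  init : ∀ ω, x 0 ω = x0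
  step : ∀ t ω, x (t + 1) ω = x t ω + η t • (H (x t ω) + w t ω - x t ω)
  adapted : ∀ t, StronglyMeasurable[ℱ t] (x t)
  integrable : ∀ t, Integrable (w t) μ
  integrable_sq : ∀ t, Integrable (fun ω => p (w t ω) ^ 2) μ
  second_moment : ∀ t, ∀ᵐ ω ∂μ,
    (μ[fun ω' => p (w t ω') ^ 2 | ℱ t]) ω ≤ A + B * p (x t ω - xstar) ^ 2
  bias : ∀ t, ∀ᵐ ω ∂μ, p ((μ[w t | ℱ t]) ω) ≤ ε

end

end BiasedSA

/-! The semi-Lyapunov function $M$ is analysed as a Moreau envelope. Since `N` induces `p` modulo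
constants, the infimum over $c$ can be absorbed into the first norm: $M$ is the envelope of
$\tfrac12 p^2$ itself (`IsSmoothing.lyap_eq`). Two properties follow. First, $\sqrt M$ is convex
(`moreau_convexComb_le`). Second, $M$ is $\sigma/\theta$-smooth (`IsSmoothing.moreau_smooth`), and
because it ignores constants, `s` may be replaced by its quotient (`IsSmoothWrt.quot`). As
$\theta\to0$ the comparison constants approach each other, which yields (ii).

For (iii), let $z=x^t-x^*$ and $y=H(x^t)-x^*$, so that $p(y)\le\gamma p(z)$. Convexity of $\sqrt M$
bounds $\langle\nabla M(z),y-z\rangle$ by $2\sqrt{M(z)}(\sqrt{M(y)}-\sqrt{M(z)})\le-2\alpha_2M(z)$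
(`IsSmoothing.fderiv_lyap_drift`). Smoothness adds second-order terms in $p(z)^2$ and $p(w)^2$.
Under conditional expectation the linear noise term retains only the bias, weighted by $|\nabla
M(z)v|\le Gp(z)p(v)$ (`IsSmoothing.abs_fderiv_lyap_le`). With the given steps, $m_t=\mathbb E
M(x^t-x^*)$ satisfies a scalar recursion with factor $1-2/(t+K)+K/(t+K)^2$, bounded explicitly in
`le_of_stepsize_recursion`. -/

namespace BiasedSA

/-! ### Quotient semi-norms modulo constant vectors. -/

section Quot

variable {ι : Type*} (N : Seminorm ℝ (ι → ℝ))

lemma quot_bddBelow (x : ι → ℝ) :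
    BddBelow (Set.range fun c : ℝ => N (x - c • (1 : ι → ℝ))) :=
  ⟨0, by rintro _ ⟨c, rfl⟩; exact apply_nonneg N _⟩

lemma quot_le_sub (x : ι → ℝ) (c : ℝ) : quot N x ≤ N (x - c • (1 : ι → ℝ)) :=
  ciInf_le (quot_bddBelow N x) c

lemma quot_le_self (x : ι → ℝ) : quot N x ≤ N x := by
  simpa using quot_le_sub N x 0

lemma quot_nonneg (x : ι → ℝ) : 0 ≤ quot N x :=
  Real.iInf_nonneg fun _ => apply_nonneg N _

/-- A quantity below `½ N(x - c e)²` for all `c` is below `½ ‖x‖_{N,E}²`. -/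
lemma le_half_quot_sq {D : ℝ} {x : ι → ℝ} (h : ∀ c : ℝ, D ≤ 1 / 2 * N (x - c • (1 : ι → ℝ)) ^ 2) :
    D ≤ 1 / 2 * quot N x ^ 2 := by
  rcases le_or_gt D 0 with hD | hD
  · exact hD.trans (by positivity)
  -- Comparing square roots before taking the infimum avoids commuting the infimum with squaring.
  have h1 : Real.sqrt (2 * D) ≤ quot N x :=
    le_ciInf fun c => Real.sqrt_le_iff.2 ⟨apply_nonneg N _, by linarith [h c]⟩
  have h2 : 2 * D ≤ quot N x ^ 2 := by
    rw [← Real.sq_sqrt (show 0 ≤ 2 * D by positivity)]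
    exact pow_le_pow_left₀ (Real.sqrt_nonneg _) h1 2
  linarith

end Quot

/-! ### The Moreau envelope: attainment and convexity of its square root. -/

section Moreau

variable {ι : Type*} {p s : Seminorm ℝ (ι → ℝ)} {θ : ℝ}

lemma moreau_le (hθ : 0 < θ) (x u : ι → ℝ) :
    moreau p s θ x ≤ 1 / 2 * p u ^ 2 + 1 / θ * (1 / 2 * s (x - u) ^ 2) :=
  ciInf_le ⟨0, by rintro _ ⟨c, rfl⟩; positivity⟩ u

lemma moreau_nonneg (hθ : 0 < θ) (x : ι → ℝ) : 0 ≤ moreau p s θ x :=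
  Real.iInf_nonneg fun _ => by positivity

lemma moreau_le_half_sq (hθ : 0 < θ) (x : ι → ℝ) : moreau p s θ x ≤ 1 / 2 * p x ^ 2 := by
  simpa using moreau_le (p := p) (s := s) hθ x x

lemma moreau_zero (hθ : 0 < θ) : moreau p s θ 0 = 0 :=
  le_antisymm (by simpa using moreau_le_half_sq (p := p) (s := s) hθ 0) (moreau_nonneg hθ 0)

variable [Fintype ι]

lemma seminorm_continuous (N : Seminorm ℝ (ι → ℝ)) : Continuous N :=
  N.convexOn.locallyLipschitz.continuous

/-- A norm on a finite-dimensional space dominates every semi-norm. -/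
lemma exists_le_mul_norm (N s : Seminorm ℝ (ι → ℝ)) (hN : ∀ x, N x = 0 → x = 0) :
    ∃ C : ℝ, 0 < C ∧ ∀ x, s x ≤ C * N x := by
  have hpos : ∀ x, x ≠ 0 → 0 < N x := fun x hx =>
    lt_of_le_of_ne (apply_nonneg N x) fun h => hx (hN x h.symm)
  have hcont : ContinuousOn (fun x => s x / N x) (Metric.sphere (0 : ι → ℝ) 1) := by
    refine (seminorm_continuous s).continuousOn.div (seminorm_continuous N).continuousOn ?_
    intro x hx
    exact (hpos x (ne_zero_of_mem_unit_sphere (⟨x, hx⟩ : Metric.sphere (0 : ι → ℝ) 1))).ne'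
  obtain ⟨C, hC⟩ := ((isCompact_sphere (0 : ι → ℝ) 1).image_of_continuousOn hcont).bddAbove
  -- The maximum with 1 keeps the constant positive even if `s` vanishes or the sphere is empty.
  refine ⟨max C 1, by positivity, fun x => ?_⟩
  rcases eq_or_ne x 0 with rfl | hx
  · simp
  have hx' : 0 < ‖x‖ := norm_pos_iff.2 hx
  have hmem : ‖x‖⁻¹ • x ∈ Metric.sphere (0 : ι → ℝ) 1 := by
    simp [norm_smul, hx'.ne']
  have h := hC ⟨_, hmem, rfl⟩
  simp only [map_smul_eq_mul, norm_inv, norm_norm] at h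
  rw [mul_div_mul_left _ _ (inv_ne_zero hx'.ne'), div_le_iff₀ (hpos x hx)] at h
  exact h.trans (mul_le_mul_of_nonneg_right (le_max_left _ _) (apply_nonneg N x))

/-- The infimum defining the Moreau envelope is attained when `s` is a norm. -/
lemma exists_moreau_eq (hθ : 0 < θ) (hs : ∀ x, s x = 0 → x = 0) (x : ι → ℝ) :
    ∃ u, moreau p s θ x = 1 / 2 * p u ^ 2 + 1 / θ * (1 / 2 * s (x - u) ^ 2) := by
  obtain ⟨C, hC, hle⟩ := exists_le_mul_norm s (normSeminorm ℝ (ι → ℝ)) hs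
  have hcont : Continuous fun u => 1 / 2 * p u ^ 2 + 1 / θ * (1 / 2 * s (x - u) ^ 2) := by
    have hp := seminorm_continuous p
    have hs := seminorm_continuous s
    fun_prop
  have hlim : Filter.Tendsto (fun u => 1 / 2 * p u ^ 2 + 1 / θ * (1 / 2 * s (x - u) ^ 2))
      (Filter.cocompact (ι → ℝ)) Filter.atTop := by
    -- Coercivity: `s (x - u)` is at least a multiple of $\|u\|-\|x\|$.
    have h1 : Filter.Tendsto (fun u : ι → ℝ => 1 / θ * (1 / 2 * (C⁻¹ * (‖u‖ - ‖x‖)) ^ 2))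
        (Filter.cocompact (ι → ℝ)) Filter.atTop := by
      refine Filter.Tendsto.const_mul_atTop (by positivity) ?_
      refine Filter.Tendsto.const_mul_atTop (by positivity) ?_
      refine (Filter.tendsto_pow_atTop two_ne_zero).comp ?_
      refine Filter.Tendsto.const_mul_atTop (by positivity) ?_
      exact Filter.tendsto_atTop_add_const_right _ _ (tendsto_norm_cocompact_atTop (E := ι → ℝ))
    refine Filter.tendsto_atTop_mono' _ ?_ h1
    have h0 := (tendsto_norm_cocompact_atTop (E := ι → ℝ)).eventually_ge_atTop ‖x‖
    filter_upwards [h0] with u hu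
    have h2 : C⁻¹ * (‖u‖ - ‖x‖) ≤ s (x - u) := by
      rw [inv_mul_le_iff₀ hC]
      calc ‖u‖ - ‖x‖ ≤ ‖u - x‖ := norm_sub_norm_le u x
        _ = ‖x - u‖ := norm_sub_rev u x
        _ ≤ C * s (x - u) := hle (x - u)
    have h3 : (C⁻¹ * (‖u‖ - ‖x‖)) ^ 2 ≤ s (x - u) ^ 2 :=
      pow_le_pow_left₀ (mul_nonneg (by positivity) (sub_nonneg.2 hu)) h2 2
    have h4 : 0 ≤ 1 / 2 * p u ^ 2 := by positivity
    have h5 := mul_le_mul_of_nonneg_left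
      (mul_le_mul_of_nonneg_left h3 (by norm_num : (0 : ℝ) ≤ 1 / 2))
      (by positivity : (0 : ℝ) ≤ 1 / θ)
    linarith
  obtain ⟨u, hu⟩ := hcont.exists_forall_le hlim
  exact ⟨u, le_antisymm (moreau_le hθ x u) (le_ciInf hu)⟩

/-- The square root of the Moreau envelope of a semi-norm is convex. -/
lemma moreau_convexComb_le (hθ : 0 < θ) (hs : ∀ x, s x = 0 → x = 0) (x y : ι → ℝ) {a b : ℝ}
    (ha : 0 ≤ a) (hb : 0 ≤ b) :
    moreau p s θ (a • x + b • y) ≤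
      (a * Real.sqrt (moreau p s θ x) + b * Real.sqrt (moreau p s θ y)) ^ 2 := by
  obtain ⟨u, hu⟩ := exists_moreau_eq (p := p) hθ hs x
  obtain ⟨v, hv⟩ := exists_moreau_eq (p := p) hθ hs y
  have hX := Real.sq_sqrt (moreau_nonneg (p := p) (s := s) hθ x)
  have hY := Real.sq_sqrt (moreau_nonneg (p := p) (s := s) hθ y)
  have hX0 := Real.sqrt_nonneg (moreau p s θ x)
  have hY0 := Real.sqrt_nonneg (moreau p s θ y)
  set X := Real.sqrt (moreau p s θ x)
  set Y := Real.sqrt (moreau p s θ y)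
  rw [hu] at hX
  rw [hv] at hY
  have hcomb : ∀ q : Seminorm ℝ (ι → ℝ), ∀ z w, q (a • z + b • w) ≤ a * q z + b * q w := by
    intro q z w
    refine (map_add_le_add q _ _).trans ?_
    simp [map_smul_eq_mul, abs_of_nonneg ha, abs_of_nonneg hb]
  have h1 := hcomb p u v
  have h2 := hcomb s (x - u) (y - v)
  have h3 : a • x + b • y - (a • u + b • v) = a • (x - u) + b • (y - v) := by
    simp only [smul_sub]; abel
  refine (moreau_le hθ _ (a • u + b • v)).trans ?_
  rw [h3]
  have hp1 := pow_le_pow_left₀ (apply_nonneg p _) h1 2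
  have hs1 := pow_le_pow_left₀ (apply_nonneg s _) h2 2
  have hκ : 0 < 1 / θ := by positivity
  generalize 1 / θ = κ at *
  have hs2 := mul_le_mul_of_nonneg_left hs1 hκ.le
  set p1 := p u
  set p2 := p v
  set s1 := s (x - u)
  set s2 := s (y - v)
  -- Cauchy–Schwarz for the form whose diagonal values are $X^2$ and $Y^2$; the defect is
  -- $\tfrac\kappa4(p_1s_2-p_2s_1)^2$.
  have hcross : 1 / 2 * (p1 * p2) + κ * (1 / 2 * (s1 * s2)) ≤ X * Y := by
    refine abs_le_of_sq_le_sq' ?_ (mul_nonneg hX0 hY0) |>.2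
    rw [mul_pow, hX, hY]
    nlinarith [mul_nonneg hκ.le (sq_nonneg (p1 * s2 - p2 * s1))]
  have := mul_le_mul_of_nonneg_left hcross (mul_nonneg ha hb)
  have e : (a * X + b * Y) ^ 2 = a ^ 2 * X ^ 2 + b ^ 2 * Y ^ 2 + 2 * (a * b * (X * Y)) := by ring
  rw [e, hX, hY]
  nlinarith

end Moreau

/-! ### The semi-Lyapunov function as the envelope of `p`. -/

section Lyap

variable {ι : Type*} {p N s : Seminorm ℝ (ι → ℝ)} {θ σ : ℝ}

/-- The infimum over the constant vectors may be moved to the first norm. -/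
lemma IsSmoothing.lyap_eq (h : IsSmoothing p N s θ σ) : lyap N s θ = moreau p s θ := by
  have hθ := h.theta_pos
  have hpN : ∀ u, p u ≤ N u := fun u => by rw [← h.quot_N]; exact quot_le_self N u
  have hbdd : ∀ x : ι → ℝ,
      BddBelow (Set.range fun c : ℝ => moreau N s θ (x - c • (1 : ι → ℝ))) :=
    fun x => ⟨0, by rintro _ ⟨c, rfl⟩; exact moreau_nonneg hθ _⟩
  have hpe : ∀ (u : ι → ℝ) (c : ℝ), p (u + c • (1 : ι → ℝ)) ≤ N u := by
    intro u c
    rw [← h.quot_N]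
    simpa using quot_le_sub N (u + c • (1 : ι → ℝ)) c
  funext x
  refine le_antisymm (le_ciInf fun u => ?_) (le_ciInf fun c => le_ciInf fun u => ?_)
  · have h1 : lyap N s θ x - 1 / θ * (1 / 2 * s (x - u) ^ 2) ≤ 1 / 2 * quot N u ^ 2 := by
      -- Shifting `x` and `u` by the same constant vector leaves the `s` term fixed while the `N`
      -- term runs over the coset of `u`.
      refine le_half_quot_sq N fun c => ?_
      have h2 := (ciInf_le (hbdd x) c).trans
        (moreau_le hθ (x - c • (1 : ι → ℝ)) (u - c • (1 : ι → ℝ)))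
      rw [sub_sub_sub_cancel_right] at h2
      exact sub_le_iff_le_add.2 h2
    rw [h.quot_N] at h1
    linarith
  · refine (moreau_le hθ x (u + c • (1 : ι → ℝ))).trans ?_
    have h1 := pow_le_pow_left₀ (apply_nonneg p _) (hpe u c) 2
    rw [show x - (u + c • (1 : ι → ℝ)) = x - c • (1 : ι → ℝ) - u by abel]
    linarith

end Lyap

/-! ### Smoothness and comparison constants. -/

/-- A midpoint-convex function with an upper quadratic model at `x` is differentiable there. -/
lemma hasFDerivAt_of_midpoint_of_le {E : Type*} [NormedAddCommGroup E] [NormedSpace ℝ E]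
    {f : E → ℝ} {x : E} {v : E →L[ℝ] ℝ} {C : ℝ}
    (hmid : ∀ d, 2 * f x ≤ f (x + d) + f (x - d))
    (hup : ∀ d, f (x + d) ≤ f x + v d + C * ‖d‖ ^ 2) : HasFDerivAt f v x := by
  rw [hasFDerivAt_iff_isLittleO_nhds_zero]
  have h1 : (fun d => f (x + d) - f x - v d) =O[nhds 0] fun d : E => ‖d‖ ^ 2 := by
    refine Asymptotics.IsBigO.of_bound C (Filter.Eventually.of_forall fun d => ?_)
    have h2 := hup d
    -- Midpoint convexity turns the upper model at $-d$ into a lower bound at $d$.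
    have h3 := hup (-d)
    rw [← sub_eq_add_neg, map_neg, norm_neg] at h3
    have h4 := hmid d
    rw [Real.norm_eq_abs, Real.norm_of_nonneg (by positivity), abs_le]
    constructor <;> linarith
  exact h1.trans_isLittleO (Asymptotics.isLittleO_norm_pow_id one_lt_two)

lemma lyap_sub_smul_one {ι : Type*} {N s : Seminorm ℝ (ι → ℝ)} {θ : ℝ} (x : ι → ℝ) (c : ℝ) :
    lyap N s θ (x - c • (1 : ι → ℝ)) = lyap N s θ x := by
  refine Equiv.iInf_congr (Equiv.addLeft c) fun c' => ?_
  rw [Equiv.coe_addLeft, add_smul, sub_sub]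

section Constants

variable {ι : Type*} [Fintype ι] {p N s : Seminorm ℝ (ι → ℝ)} {θ σ : ℝ}

lemma moreau_midpoint (hθ : 0 < θ) (hs : ∀ x, s x = 0 → x = 0) (x d : ι → ℝ) :
    2 * moreau p s θ x ≤ moreau p s θ (x + d) + moreau p s θ (x - d) := by
  have h := moreau_convexComb_le (p := p) hθ hs (x + d) (x - d)
    (show (0 : ℝ) ≤ 1 / 2 by norm_num) (show (0 : ℝ) ≤ 1 / 2 by norm_num)
  have e : (1 / 2 : ℝ) • (x + d) + (1 / 2 : ℝ) • (x - d) = x := by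
    rw [← smul_add, add_add_sub_cancel, ← two_smul ℝ x, smul_smul]; norm_num
  rw [e] at h
  have hX := Real.sq_sqrt (moreau_nonneg (p := p) (s := s) hθ (x + d))
  have hY := Real.sq_sqrt (moreau_nonneg (p := p) (s := s) hθ (x - d))
  nlinarith [sq_nonneg (Real.sqrt (moreau p s θ (x + d)) - Real.sqrt (moreau p s θ (x - d)))]

/-- The Moreau envelope inherits smoothness from `s`. -/
lemma IsSmoothing.moreau_smooth (h : IsSmoothing p N s θ σ) :
    IsSmoothWrt (moreau p s θ) (σ / θ) s := by
  have hθ := h.theta_pos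
  obtain ⟨C, hC, hsC⟩ := exists_le_mul_norm (normSeminorm ℝ (ι → ℝ)) s (fun x => by simp)
  have key : ∀ x, ∃ v : (ι → ℝ) →L[ℝ] ℝ, HasFDerivAt (moreau p s θ) v x ∧
      ∀ d, moreau p s θ (x + d) ≤ moreau p s θ x + v d + σ / θ / 2 * s d ^ 2 := by
    intro x
    obtain ⟨u, hu⟩ := exists_moreau_eq (p := p) hθ h.norm_s x
    -- Keep the minimizer `u` of `x` as a competitor at `x + d`: only the smooth `s` term then
    -- varies.
    have hup : ∀ d, moreau p s θ (x + d) ≤ moreau p s θ x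
        + ((1 / θ) • fderiv ℝ (fun x => 1 / 2 * s x ^ 2) (x - u)) d + σ / θ / 2 * s d ^ 2 := by
      intro d
      have h1 := moreau_le (p := p) (s := s) hθ (x + d) u
      have h2 := h.smooth_s.2 (x - u) (x + d - u)
      rw [show x + d - u - (x - u) = d by abel] at h2
      have h3 := mul_le_mul_of_nonneg_left h2 (one_div_pos.2 hθ).le
      rw [hu, _root_.smul_apply, smul_eq_mul]
      have e : σ / θ / 2 * s d ^ 2 = 1 / θ * (σ / 2 * s d ^ 2) := by ring
      rw [e]
      linarith
    refine ⟨_, hasFDerivAt_of_midpoint_of_le (C := σ / θ / 2 * C ^ 2)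
      (moreau_midpoint hθ h.norm_s x) fun d => (hup d).trans ?_, hup⟩
    have h4 := pow_le_pow_left₀ (apply_nonneg s d) (hsC d) 2
    have h5 : 0 < σ / θ / 2 := by have := h.sigma_pos; positivity
    have h6 := mul_le_mul_of_nonneg_left h4 h5.le
    rw [coe_normSeminorm, mul_pow] at h6
    linarith
  refine ⟨fun x => (key x).choose_spec.1.differentiableAt, fun x y => ?_⟩
  obtain ⟨v, hv, hup⟩ := key x
  have := hup (y - x)
  rwa [add_sub_cancel, ← hv.fderiv] at this

/-- A function invariant under constant vectors is as smooth with respect to `‖·‖_{s,E}` as with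
respect to `s`. -/
lemma IsSmoothWrt.quot {f : (ι → ℝ) → ℝ} {L : ℝ} (hL : 0 < L) (hf : IsSmoothWrt f L s)
    (hinv : ∀ x (c : ℝ), f (x - c • (1 : ι → ℝ)) = f x) : IsSmoothWrt f L (quot s) := by
  refine ⟨hf.1, fun x y => ?_⟩
  -- Shifting `y` by constants thus changes neither `f y` nor the linear term, so the quadratic term
  -- can be minimized over the shift.
  have h0 : fderiv ℝ f x 1 = 0 := by
    have h1 := ((hf.1 x).hasFDerivAt.hasLineDerivAt (1 : ι → ℝ))
    have h2 : (fun t : ℝ => f (x + t • (1 : ι → ℝ))) = fun _ => f x := by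
      funext t
      have := hinv x (-t)
      rwa [neg_smul, sub_neg_eq_add] at this
    unfold HasLineDerivAt at h1
    rw [h2] at h1
    exact h1.unique (hasDerivAt_const 0 (f x))
  have h1 : (f y - f x - fderiv ℝ f x (y - x)) / L ≤ 1 / 2 * BiasedSA.quot s (y - x) ^ 2 := by
    refine le_half_quot_sq s fun c => ?_
    have h2 := hf.2 x (y - c • (1 : ι → ℝ))
    rw [hinv, sub_right_comm, map_sub, map_smul, h0, smul_zero, sub_zero] at h2
    rw [div_le_iff₀ hL]
    linarith
  rw [div_le_iff₀ hL] at h1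
  linarith

/-- Taking $u=x$ in the envelope gives $c_l=1$. For $c_u$, take the minimizer $u$ and apply
Cauchy–Schwarz: $(p(u)+k\,s(x-u))^2\le(1+\theta k^2)(p(u)^2+s(x-u)^2/\theta)$. -/
lemma IsSmoothing.isConstants (h : IsSmoothing p N s θ σ) {k ρ : ℝ} (hk : ∀ x, p x ≤ k * s x)
    (hρ : 0 < ρ) (hsN : ∀ x, s x ≤ ρ * N x) :
    IsConstants p N s θ 1 (1 + θ * k ^ 2) (σ / θ) ρ := by
  have hθ := h.theta_pos
  have hσ := h.sigma_pos
  refine ⟨one_pos, by positivity, by positivity, hρ, fun x => ?_, fun x => ?_, ?_, fun x => ?_⟩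
  · rw [h.lyap_eq, one_mul]
    exact moreau_le_half_sq hθ x
  · rw [h.lyap_eq]
    obtain ⟨u, hu⟩ := exists_moreau_eq (p := p) hθ h.norm_s x
    have h1 : p x ≤ p u + k * s (x - u) := by
      have := map_add_le_add p u (x - u)
      rw [add_sub_cancel] at this
      exact this.trans (by gcongr; exact hk _)
    have h2 := pow_le_pow_left₀ (apply_nonneg p _) h1 2
    rw [hu]
    have hκ : 0 < 1 / θ := by positivity
    have hθκ : θ * (1 / θ) = 1 := by field_simp
    generalize 1 / θ = κ at *
    have h3 := mul_nonneg hκ.le (sq_nonneg (θ * k * p u - s (x - u)))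
    have e : κ * (θ * k * p u - s (x - u)) ^ 2 = (θ * κ) * θ * (k * p u) ^ 2
        - 2 * (θ * κ) * (k * p u * s (x - u)) + κ * s (x - u) ^ 2 := by ring
    rw [e, hθκ] at h3
    have e2 : (1 + θ * k ^ 2) * (1 / 2 * p u ^ 2 + κ * (1 / 2 * s (x - u) ^ 2)) =
      1 / 2 * (p u ^ 2 + θ * (k * p u) ^ 2 + κ * s (x - u) ^ 2
        + (θ * κ) * (k * s (x - u)) ^ 2) := by ring
    rw [e2, hθκ]
    linarith
  · refine IsSmoothWrt.quot (by positivity) ?_ lyap_sub_smul_one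
    rw [h.lyap_eq]
    exact h.moreau_smooth
  · rw [← h.quot_N, BiasedSA.quot, BiasedSA.quot, Real.mul_iInf_of_nonneg hρ.le]
    exact ciInf_mono (quot_bddBelow s x) fun c => hsN _

end Constants

/-! ### A Euclidean smoothing with good drift constant. -/

section Existence

variable (ι : Type*) [Fintype ι]

/-- The Euclidean norm, as a semi-norm on `ι → ℝ`. -/
noncomputable def euclideanSeminorm : Seminorm ℝ (ι → ℝ) :=
  (normSeminorm ℝ (EuclideanSpace ℝ ι)).comp (WithLp.linearEquiv 2 ℝ (ι → ℝ)).symm.toLinearMap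

variable {ι}

lemma euclideanSeminorm_sq (x : ι → ℝ) : euclideanSeminorm ι x ^ 2 = ∑ i, x i ^ 2 := by
  simp [euclideanSeminorm, EuclideanSpace.norm_sq_eq]

lemma euclideanSeminorm_eq_zero (x : ι → ℝ) (hx : euclideanSeminorm ι x = 0) : x = 0 := by
  have h := euclideanSeminorm_sq x
  rw [hx, zero_pow two_ne_zero, eq_comm,
    Finset.sum_eq_zero_iff_of_nonneg fun i _ => sq_nonneg (x i)] at h
  funext i
  simpa using h i (Finset.mem_univ i)

lemma euclideanSeminorm_smooth :
    IsSmoothWrt (fun x => 1 / 2 * euclideanSeminorm ι x ^ 2) 1 (euclideanSeminorm ι) := by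
  have hd : ∀ x : ι → ℝ, HasFDerivAt (fun x => 1 / 2 * euclideanSeminorm ι x ^ 2)
      (∑ i, x i • ContinuousLinearMap.proj (R := ℝ) (φ := fun _ : ι => ℝ) i) x := by
    intro x
    have h1 : (fun x => 1 / 2 * euclideanSeminorm ι x ^ 2) = fun x => ∑ i, 1 / 2 * x i ^ 2 := by
      funext x
      rw [euclideanSeminorm_sq, Finset.mul_sum]
    rw [h1]
    refine HasFDerivAt.fun_sum fun i _ => ?_
    refine (((hasFDerivAt_apply (𝕜 := ℝ) i x).pow 2).const_mul (1 / 2)).congr_fderiv ?_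
    ext v
    simp [mul_assoc]
  refine ⟨fun x => (hd x).differentiableAt, fun x y => le_of_eq ?_⟩
  rw [(hd x).fderiv]
  simp only [euclideanSeminorm_sq, _root_.sum_apply, _root_.smul_apply,
    ContinuousLinearMap.proj_apply, smul_eq_mul, Pi.sub_apply, Finset.mul_sum]
  rw [← Finset.sum_add_distrib, ← Finset.sum_add_distrib]
  exact Finset.sum_congr rfl fun i _ => by ring

/-- The norm `p x + |∑ xᵢ|`, which induces `p` modulo constant vectors. -/
noncomputable def addAbsSum (p : Seminorm ℝ (ι → ℝ)) : Seminorm ℝ (ι → ℝ) :=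
  p + (normSeminorm ℝ ℝ).comp (∑ i, LinearMap.proj (R := ℝ) (φ := fun _ : ι => ℝ) i)

lemma addAbsSum_apply (p : Seminorm ℝ (ι → ℝ)) (x : ι → ℝ) :
    addAbsSum p x = p x + |∑ i, x i| := by
  simp [addAbsSum, LinearMap.sum_apply]

variable {p : Seminorm ℝ (ι → ℝ)}

lemma isSmoothing_addAbsSum (hp : ∀ x, p x = 0 ↔ ∃ c : ℝ, x = c • (1 : ι → ℝ)) {θ : ℝ}
    (hθ : 0 < θ) : IsSmoothing p (addAbsSum p) (euclideanSeminorm ι) θ 1 := by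
  have hpe : ∀ c : ℝ, p (c • (1 : ι → ℝ)) = 0 := fun c => (hp _).2 ⟨c, rfl⟩
  refine ⟨fun x hx => ?_, fun x => le_antisymm ?_ (le_ciInf fun c => ?_),
    euclideanSeminorm_eq_zero, hθ, one_pos, euclideanSeminorm_smooth⟩
  · rw [addAbsSum_apply] at hx
    have h1 : p x = 0 := by linarith [apply_nonneg p x, abs_nonneg (∑ i, x i)]
    have h2 : ∑ i, x i = 0 := abs_eq_zero.1 (by linarith)
    obtain ⟨c, rfl⟩ := (hp x).1 h1
    funext i
    have : (Fintype.card ι : ℝ) ≠ 0 := by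
      have : Nonempty ι := ⟨i⟩
      simp
    simpa [this] using h2
  -- Subtracting the mean kills the sum term, so the infimum reaches `p x`.
  · refine (quot_le_sub _ x ((∑ i, x i) / Fintype.card ι)).trans ?_
    have h1 : ∑ i, (x - ((∑ i, x i) / Fintype.card ι) • (1 : ι → ℝ)) i = 0 := by
      rcases isEmpty_or_nonempty ι with h | h
      · simp
      · simp [Finset.sum_sub_distrib, mul_div_cancel₀]
    rw [addAbsSum_apply, h1, abs_zero, add_zero]
    refine (map_sub_le_add p _ _).trans ?_
    rw [hpe, add_zero]
  · rw [addAbsSum_apply]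
    have h1 := map_add_le_add p (x - c • (1 : ι → ℝ)) (c • (1 : ι → ℝ))
    rw [sub_add_cancel, hpe, add_zero] at h1
    linarith [abs_nonneg (∑ i, (x - c • (1 : ι → ℝ)) i)]

lemma IsSmoothing.exists_isConstants {N s : Seminorm ℝ (ι → ℝ)} {θ σ : ℝ}
    (h : IsSmoothing p N s θ σ) :
    ∃ cl cu ρ : ℝ, IsConstants p N s θ cl cu (σ / θ) ρ := by
  obtain ⟨k, -, hk⟩ := exists_le_mul_norm s p h.norm_s
  obtain ⟨ρ, hρ, hsN⟩ := exists_le_mul_norm N s h.norm_N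
  exact ⟨_, _, _, h.isConstants hk hρ hsN⟩

lemma exists_isSmoothing_alpha2_ge (hp : ∀ x, p x = 0 ↔ ∃ c : ℝ, x = c • (1 : ι → ℝ))
    {γ : ℝ} (hγ0 : 0 < γ) (hγ1 : γ < 1) :
    ∃ (N s : Seminorm ℝ (ι → ℝ)) (θ σ cl cu L ρ : ℝ),
      IsSmoothing p N s θ σ ∧ IsConstants p N s θ cl cu L ρ ∧
      (1 - γ) / 2 ≤ alpha2 γ cl cu := by
  obtain ⟨k, hk0, hk⟩ := exists_le_mul_norm (euclideanSeminorm ι) p euclideanSeminorm_eq_zero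
  -- The target value of $\sqrt{c_u/c_l}$: then $1-\gamma r=(1-\gamma)/2$ exactly, and
  -- $\theta=(r^2-1)/k^2$ makes $1+\theta k^2=r^2$.
  set r := (1 + γ) / (2 * γ) with hr
  have hγr : γ * r = (1 + γ) / 2 := by rw [hr]; field_simp
  have hr1 : 1 < r := by rw [hr, lt_div_iff₀ (by positivity)]; linarith
  have hθ : 0 < (r ^ 2 - 1) / k ^ 2 := div_pos (by nlinarith) (by positivity)
  have h := isSmoothing_addAbsSum hp hθ
  obtain ⟨ρ, hρ, hsN⟩ := exists_le_mul_norm _ (euclideanSeminorm ι) h.norm_N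
  refine ⟨_, _, _, _, _, _, _, _, h, h.isConstants hk hρ hsN, ?_⟩
  have e : 1 + (r ^ 2 - 1) / k ^ 2 * k ^ 2 = r ^ 2 := by
    rw [div_mul_cancel₀ _ (by positivity)]; ring
  rw [alpha2, e, div_one, Real.sqrt_sq (by linarith), hγr]
  linarith

end Existence

/-! ### Drift, gradient bound and the pathwise one-step inequality. -/

section Drift

variable {ι : Type*} {p N s : Seminorm ℝ (ι → ℝ)} {θ σ cl cu L ρ : ℝ}

lemma IsSmoothing.lyap_nonneg (h : IsSmoothing p N s θ σ) (x : ι → ℝ) : 0 ≤ lyap N s θ x := by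
  rw [h.lyap_eq]
  exact moreau_nonneg h.theta_pos x

lemma IsSmoothing.lyap_zero (h : IsSmoothing p N s θ σ) : lyap N s θ 0 = 0 := by
  rw [h.lyap_eq]
  exact moreau_zero h.theta_pos

lemma IsConstants.quot_sq_le (hc : IsConstants p N s θ cl cu L ρ) (v : ι → ℝ) :
    L / 2 * quot s v ^ 2 ≤ ρ ^ 2 * L / 2 * p v ^ 2 := by
  have h1 := pow_le_pow_left₀ (quot_nonneg s v) (hc.quot_le v) 2
  have h2 := mul_le_mul_of_nonneg_left h1 (half_pos hc.L_pos).le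
  linarith

/-- A function that is nonnegative to the right of a zero has nonnegative derivative there. -/
lemma hasDerivAt_nonneg_of_nonneg_right {g : ℝ → ℝ} {g' : ℝ} (hg : HasDerivAt g g' 0)
    (h0 : g 0 = 0) (h1 : ∀ t, 0 < t → t < 1 → 0 ≤ g t) : 0 ≤ g' := by
  refine ge_of_tendsto hg.tendsto_slope_zero_right ?_
  filter_upwards [Ioo_mem_nhdsGT (zero_lt_one' ℝ)] with t ht
  rw [zero_add, h0, sub_zero, smul_eq_mul]
  exact mul_nonneg (inv_nonneg.2 ht.1.le) (h1 t ht.1 ht.2)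

variable [Fintype ι]

/-- Along the segment from `z` to `y`, convexity of $\sqrt M$ puts $M$ below the square of the
linear interpolation of $\sqrt M$. Both agree at $t=0$, so their derivatives there compare. -/
lemma IsSmoothing.fderiv_lyap_sub_le (h : IsSmoothing p N s θ σ)
    (hd : Differentiable ℝ (lyap N s θ)) (z y : ι → ℝ) :
    fderiv ℝ (lyap N s θ) z (y - z) ≤
      2 * Real.sqrt (lyap N s θ z) * (Real.sqrt (lyap N s θ y) - Real.sqrt (lyap N s θ z)) := by
  set X := Real.sqrt (lyap N s θ z) with hX
  set Y := Real.sqrt (lyap N s θ y) with hY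
  have h1 : HasDerivAt (fun t : ℝ => lyap N s θ (z + t • (y - z)))
      (fderiv ℝ (lyap N s θ) z (y - z)) 0 := (hd z).hasFDerivAt.hasLineDerivAt (y - z)
  have h2 : HasDerivAt (fun t : ℝ => (X + t * (Y - X)) ^ 2) (2 * X * (Y - X)) 0 := by
    have := (((hasDerivAt_id (0 : ℝ)).mul_const (Y - X)).const_add X).fun_pow 2
    simpa using this
  refine sub_nonneg.1 (hasDerivAt_nonneg_of_nonneg_right (h2.sub h1) ?_ fun t ht0 ht1 => ?_)
  · simp [hX, Real.sq_sqrt (h.lyap_nonneg z)]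
  · have h3 := moreau_convexComb_le (p := p) h.theta_pos h.norm_s z y
      (sub_nonneg.2 ht1.le) ht0.le
    rw [← h.lyap_eq, ← hX, ← hY] at h3
    rw [show (1 - t) • z + t • y = z + t • (y - z) by
      rw [sub_smul, one_smul, smul_sub]; abel] at h3
    refine sub_nonneg.2 (h3.trans (le_of_eq ?_))
    ring

/-- Negative drift of the semi-Lyapunov function along a `γ`-contraction. -/
lemma IsSmoothing.fderiv_lyap_drift (h : IsSmoothing p N s θ σ)
    (hc : IsConstants p N s θ cl cu L ρ) {γ : ℝ} (hγ : 0 ≤ γ) {z y : ι → ℝ}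
    (hy : p y ≤ γ * p z) :
    fderiv ℝ (lyap N s θ) z (y - z) ≤ -(2 * alpha2 γ cl cu * lyap N s θ z) := by
  have hcl := hc.cl_pos
  have hcu := hc.cu_pos
  have hz0 := h.lyap_nonneg z
  have h1 : lyap N s θ y ≤ γ ^ 2 * (cu / cl) * lyap N s θ z := by
    have h2 := hc.lower y
    have h3 := hc.upper z
    have h4 := pow_le_pow_left₀ (apply_nonneg p y) hy 2
    have h5 := mul_le_mul_of_nonneg_left h3 (sq_nonneg γ)
    have e : γ ^ 2 * (cu / cl) * lyap N s θ z = γ ^ 2 * (cu * lyap N s θ z) / cl := by ring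
    rw [e, le_div_iff₀ hcl]
    linarith
  have h2 : Real.sqrt (lyap N s θ y) ≤ γ * Real.sqrt (cu / cl) * Real.sqrt (lyap N s θ z) := by
    refine (Real.sqrt_le_sqrt h1).trans (le_of_eq ?_)
    rw [Real.sqrt_mul (by positivity), Real.sqrt_mul (by positivity), Real.sqrt_sq hγ]
  refine (h.fderiv_lyap_sub_le hc.smooth.1 z y).trans ?_
  have h3 := mul_le_mul_of_nonneg_left h2 (Real.sqrt_nonneg (lyap N s θ z))
  have h4 := Real.sq_sqrt hz0
  rw [alpha2]
  linear_combination 2 * h3 + (2 * (γ * Real.sqrt (cu / cl)) - 2) * h4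

/-- Smoothness at the minimizer 0 gives $M(z)\le\tfrac G2p(z)^2$ with $G=\rho^2L$. Nonnegativity of
$M(z+tv)$ then makes a quadratic in $t$ nonnegative, and its discriminant gives the bound. -/
lemma IsSmoothing.abs_fderiv_lyap_le (h : IsSmoothing p N s θ σ)
    (hc : IsConstants p N s θ cl cu L ρ) (z v : ι → ℝ) :
    |fderiv ℝ (lyap N s θ) z v| ≤ ρ ^ 2 * L * p z * p v := by
  have hG : 0 < ρ ^ 2 * L := mul_pos (pow_pos hc.rho_pos 2) hc.L_pos
  have hmin : fderiv ℝ (lyap N s θ) 0 = 0 :=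
    IsLocalMin.fderiv_eq_zero (Filter.Eventually.of_forall fun y => by
      rw [h.lyap_zero]; exact h.lyap_nonneg y)
  have hz : lyap N s θ z ≤ ρ ^ 2 * L / 2 * p z ^ 2 := by
    have h1 := hc.smooth.2 0 z
    rw [hmin, h.lyap_zero, sub_zero, _root_.zero_apply, zero_add, zero_add] at h1
    exact h1.trans (hc.quot_sq_le z)
  have hq : ∀ t : ℝ, 0 ≤ ρ ^ 2 * L / 2 * p v ^ 2 * (t * t) + fderiv ℝ (lyap N s θ) z v * t
      + ρ ^ 2 * L / 2 * p z ^ 2 := by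
    intro t
    have h1 := hc.smooth.2 z (z + t • v)
    have h2 := hc.quot_sq_le (t • v)
    have h3 := h.lyap_nonneg (z + t • v)
    rw [add_sub_cancel_left, map_smul, smul_eq_mul] at h1
    rw [map_smul_eq_mul, mul_pow, Real.norm_eq_abs, sq_abs] at h2
    linarith
  have h1 := discrim_le_zero hq
  rw [discrim] at h1
  refine abs_le_of_sq_le_sq ?_ (by positivity)
  linarith

/-- One step of the stochastic approximation, before taking expectations. -/
lemma IsSmoothing.lyap_step_le (h : IsSmoothing p N s θ σ)
    (hc : IsConstants p N s θ cl cu L ρ) {γ : ℝ} (hγ0 : 0 ≤ γ) (hγ1 : γ ≤ 1) {z y w : ι → ℝ}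
    (hy : p y ≤ γ * p z) {η : ℝ} (hη : 0 ≤ η) :
    lyap N s θ (z + η • (y - z + w)) ≤ (1 - 2 * alpha2 γ cl cu * η) * lyap N s θ z
      + η * fderiv ℝ (lyap N s θ) z w + η ^ 2 * (ρ ^ 2 * L) * (4 * p z ^ 2 + p w ^ 2) := by
  have hG : 0 < ρ ^ 2 * L := mul_pos (pow_pos hc.rho_pos 2) hc.L_pos
  have h1 := hc.smooth.2 z (z + η • (y - z + w))
  rw [add_sub_cancel_left, map_smul, smul_eq_mul, map_add] at h1
  have h2 := hc.quot_sq_le (η • (y - z + w))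
  rw [map_smul_eq_mul, mul_pow, Real.norm_eq_abs, sq_abs] at h2
  have h3 := mul_le_mul_of_nonneg_left (h.fderiv_lyap_drift hc hγ0 hy) hη
  have h4 : p (y - z + w) ≤ 2 * p z + p w := by
    have h5 := map_add_le_add p (y - z) w
    have h6 := map_sub_le_add p y z
    have h7 := mul_le_of_le_one_left (apply_nonneg p z) hγ1
    linarith
  -- After halving, the 8 leaves $4p(z)^2$; with $p^2\le2c_uM$ this becomes the $8c_u$ of
  -- $\alpha_3$.
  have h5 : p (y - z + w) ^ 2 ≤ 8 * p z ^ 2 + 2 * p w ^ 2 := by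
    have := pow_le_pow_left₀ (apply_nonneg p _) h4 2
    linarith [sq_nonneg (2 * p z - p w)]
  have h6 := mul_le_mul_of_nonneg_left h5 (by positivity : 0 ≤ ρ ^ 2 * L / 2 * η ^ 2)
  linarith

end Drift

/-! ### The scalar recursion. -/

section Recursion

lemma stepsize_factor_eq {a K : ℝ} (ha : 0 < a) :
    1 - 2 / a + K / a ^ 2 = ((a - 1) ^ 2 + K - 1) / a ^ 2 := by
  field_simp
  ring

lemma stepsize_factor_mul_initial_le {a K : ℝ} (hK : 0 < K) (ha : K ≤ a) :
    (1 - 2 / a + K / a ^ 2) * (4 * K ^ 2 / (a + K) ^ 2) ≤ 4 * K ^ 2 / (a + 1 + K) ^ 2 := by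
  have ha0 : 0 < a := hK.trans_le ha
  rw [stepsize_factor_eq ha0, div_mul_div_comm, div_le_div_iff₀ (by positivity) (by positivity)]
  have key : ((a - 1) ^ 2 + K - 1) * (a + 1 + K) ^ 2 ≤ a ^ 2 * (a + K) ^ 2 := by
    obtain ⟨s, hs, rfl⟩ : ∃ s : ℝ, 0 ≤ s ∧ a = K + s := ⟨a - K, by linarith, by ring⟩
    have : 0 ≤ 3 * K ^ 2 + 2 * K ^ 2 * s + K * s ^ 2 + K + 8 * K * s + 2 * s + 3 * s ^ 2 := by
      positivity
    nlinarith
  have := mul_le_mul_of_nonneg_left key (by positivity : 0 ≤ 4 * K ^ 2)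
  linarith

lemma stepsize_factor_mul_noise_le {a K : ℝ} (hK : 3 ≤ K) (ha : K ≤ a) :
    (1 - 2 / a + K / a ^ 2) * (4 * (a - K) / a ^ 2) + 1 / a ^ 2
      ≤ 4 * (a + 1 - K) / (a + 1) ^ 2 := by
  have ha0 : 0 < a := by linarith
  have e : (1 - 2 / a + K / a ^ 2) * (4 * (a - K) / a ^ 2) + 1 / a ^ 2
      = (((a - 1) ^ 2 + K - 1) * (4 * (a - K)) + a ^ 2) / a ^ 4 := by
    rw [stepsize_factor_eq ha0]
    field_simp
  rw [e, div_le_div_iff₀ (by positivity) (by positivity)]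
  -- AM–GM for two numbers with sum $a-1$.
  have h1 : 4 * ((a - K) * (K - 1)) ≤ (a - 1) ^ 2 := by nlinarith [sq_nonneg (a - K - (K - 1))]
  have h2 := mul_le_mul_of_nonneg_right h1 (sq_nonneg (a + 1))
  have h3 : 0 ≤ 2 * a ^ 3 * (a - 3) + 4 * a ^ 2 * (a - 3) + 13 * a ^ 2 - 1 := by
    have h4 : 0 ≤ a - 3 := by linarith
    have h5 : 0 ≤ 2 * a ^ 3 * (a - 3) := by positivity
    have h6 : 0 ≤ 4 * a ^ 2 * (a - 3) := by positivity
    nlinarith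
  have h4 : 0 ≤ (a - K) * (8 * a ^ 2 - 4) := mul_nonneg (by linarith) (by nlinarith)
  linarith

/-- Explicit solution of the recursion with step sizes `1 / (t + K)`. -/
lemma le_of_stepsize_recursion {m : ℕ → ℝ} {K D F : ℝ} (hK : 3 ≤ K) (hm : ∀ t, 0 ≤ m t)
    (hD : 0 ≤ D) (hF : 0 ≤ F)
    (hrec : ∀ t : ℕ, m (t + 1) ≤ (1 - 2 / ((t : ℝ) + K) + K / ((t : ℝ) + K) ^ 2) * m t
      + D / ((t : ℝ) + K) + F / ((t : ℝ) + K) ^ 2) (T : ℕ) :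
    -- The first coefficient is 1 at $T=0$. The first two terms are propagated by the step-size
    -- lemmas; the bias sum only needs the factor to lie in $[0,1]$.
    m T ≤ 4 * K ^ 2 / ((T : ℝ) + 2 * K) ^ 2 * m 0 + F * (4 * T / ((T : ℝ) + K) ^ 2)
      + D * ∑ t ∈ Finset.range T, 1 / ((t : ℝ) + K) := by
  have hK0 : 0 < K := by linarith
  induction T with
  | zero =>
    have : 4 * K ^ 2 / (0 + 2 * K) ^ 2 = 1 := by
      rw [div_eq_one_iff_eq (by positivity)]; ring
    simp [-zero_add, this]
  | succ T ih =>
    rw [Finset.sum_range_succ]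
    set S := ∑ t ∈ Finset.range T, 1 / ((t : ℝ) + K) with hS
    have hS0 : 0 ≤ S := Finset.sum_nonneg fun t _ => by positivity
    have hT : (0 : ℝ) ≤ T := T.cast_nonneg
    push_cast
    have ha : K ≤ T + K := by linarith
    have ha0 : (0 : ℝ) < T + K := by linarith
    have h1 := stepsize_factor_mul_initial_le hK0 ha
    have h2 := stepsize_factor_mul_noise_le hK ha
    have hφ0 : 0 ≤ 1 - 2 / ((T : ℝ) + K) + K / ((T : ℝ) + K) ^ 2 := by
      rw [stepsize_factor_eq ha0]
      exact div_nonneg (by nlinarith [sq_nonneg ((T : ℝ) + K - 1)]) (by positivity)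
    have hφ1 : 1 - 2 / ((T : ℝ) + K) + K / ((T : ℝ) + K) ^ 2 ≤ 1 := by
      rw [stepsize_factor_eq ha0, div_le_one (by positivity)]
      nlinarith
    rw [show (T : ℝ) + K + K = T + 2 * K by ring,
      show (T : ℝ) + K + 1 + K = T + 1 + 2 * K by ring] at h1
    rw [show (T : ℝ) + K - K = T by ring, show (T : ℝ) + K + 1 - K = T + 1 by ring,
      show (T : ℝ) + K + 1 = T + 1 + K by ring] at h2
    have h3 := mul_le_mul_of_nonneg_left ih hφ0
    have h4 := mul_le_mul_of_nonneg_right h1 (hm 0)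
    have h5 := mul_le_mul_of_nonneg_left h2 hF
    have h6 := mul_le_mul_of_nonneg_left (mul_le_mul_of_nonneg_right hφ1 hS0) hD
    refine (hrec T).trans ?_
    rw [div_eq_mul_one_div D, div_eq_mul_one_div F]
    generalize 1 - 2 / ((T : ℝ) + K) + K / ((T : ℝ) + K) ^ 2 = φ at *
    linarith

/-- The term $t=0$ is set apart; each later one is bounded by a logarithmic increment through
$1-1/y\le\log y$, and the increments telescope. -/
lemma sum_inv_add_le {K : ℝ} (hK : 0 < K) (T : ℕ) :
    ∑ t ∈ Finset.range (T + 1), 1 / ((t : ℝ) + K) ≤ 1 / K + Real.log (((T : ℝ) + K) / K) := by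
  induction T with
  | zero => simp [hK.ne']
  | succ T ih =>
    rw [Finset.sum_range_succ]
    have hT : (0 : ℝ) ≤ T := T.cast_nonneg
    push_cast
    have h1 := Real.one_sub_inv_le_log_of_pos
      (show 0 < ((T : ℝ) + 1 + K) / (T + K) by positivity)
    have h2 : Real.log (((T : ℝ) + 1 + K) / K)
        = Real.log (((T : ℝ) + K) / K) + Real.log (((T : ℝ) + 1 + K) / (T + K)) := by
      rw [← Real.log_mul (by positivity) (by positivity)]
      congr 1
      field_simp
    have h3 : 1 - (((T : ℝ) + 1 + K) / (T + K))⁻¹ = 1 / ((T : ℝ) + 1 + K) := by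
      field_simp
      ring
    rw [h2]
    linarith

end Recursion

/-! ### Integrability, conditional expectations and the final bound. -/

section Stochastic

/-- `xstar` is fixed by `H` only modulo constants, which `p` does not see. -/
lemma seminorm_sub_fixed_le {ι : Type*} {p : Seminorm ℝ (ι → ℝ)} {H : (ι → ℝ) → (ι → ℝ)}
    {xstar : ι → ℝ} {γ : ℝ} (hp : ∀ x, p x = 0 ↔ ∃ c : ℝ, x = c • (1 : ι → ℝ))
    (hH : ∀ y z, p (H y - H z) ≤ γ * p (y - z))
    (hfix : ∃ c : ℝ, H xstar - xstar = c • (1 : ι → ℝ)) (y : ι → ℝ) :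
    p (H y - xstar) ≤ γ * p (y - xstar) := by
  have h1 := map_add_le_add p (H y - H xstar) (H xstar - xstar)
  rw [sub_add_sub_cancel, (hp _).2 hfix, add_zero] at h1
  exact h1.trans (hH y xstar)

variable {ι : Type*} [Fintype ι] {p N s : Seminorm ℝ (ι → ℝ)} {θ σ cl cu L ρ : ℝ}
  {Ω : Type*} [mΩ : MeasurableSpace Ω] {μ : Measure Ω}
  {ℱ : Filtration ℕ mΩ} {H : (ι → ℝ) → (ι → ℝ)} {xstar x0 : ι → ℝ} {η : ℕ → ℝ}
  {A B ε γ : ℝ} {x w : ℕ → Ω → (ι → ℝ)}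

lemma IsBiasedSA.sub_eq (hx : IsBiasedSA μ ℱ p H xstar x0 η A B ε x w) (t : ℕ) (ω : Ω) :
    x (t + 1) ω - xstar = (x t ω - xstar)
      + η t • ((H (x t ω) - xstar) - (x t ω - xstar) + w t ω) := by
  rw [hx.step, sub_sub_sub_cancel_right, add_sub_right_comm,
    show H (x t ω) + w t ω - x t ω = H (x t ω) - x t ω + w t ω by abel]

lemma IsBiasedSA.stronglyMeasurable_sub (hx : IsBiasedSA μ ℱ p H xstar x0 η A B ε x w) (t : ℕ) :
    StronglyMeasurable[ℱ t] fun ω => x t ω - xstar :=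
  (hx.adapted t).sub stronglyMeasurable_const

lemma IsBiasedSA.integrable_lyap (h : IsSmoothing p N s θ σ)
    (hc : IsConstants p N s θ cl cu L ρ)
    (hx : IsBiasedSA μ ℱ p H xstar x0 η A B ε x w) (t : ℕ)
    (hint : Integrable (fun ω => p (x t ω - xstar) ^ 2) μ) :
    Integrable (fun ω => lyap N s θ (x t ω - xstar)) μ := by
  refine Integrable.mono' (hint.const_mul (1 / 2 / cl))
    (hc.smooth.1.continuous.comp_stronglyMeasurable
      ((hx.stronglyMeasurable_sub t).mono (ℱ.le _))).aestronglyMeasurable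
    (Filter.Eventually.of_forall fun ω => ?_)
  rw [Real.norm_of_nonneg (h.lyap_nonneg _), div_mul_eq_mul_div, le_div_iff₀ hc.cl_pos]
  linarith [hc.lower (x t ω - xstar)]

lemma IsBiasedSA.integrable_fderiv_lyap (h : IsSmoothing p N s θ σ)
    (hc : IsConstants p N s θ cl cu L ρ)
    (hx : IsBiasedSA μ ℱ p H xstar x0 η A B ε x w) (t : ℕ)
    (hint : Integrable (fun ω => p (x t ω - xstar) ^ 2) μ) :
    StronglyMeasurable[ℱ t] (fun ω => fderiv ℝ (lyap N s θ) (x t ω - xstar)) ∧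
    Integrable (fun ω => fderiv ℝ (lyap N s θ) (x t ω - xstar) (w t ω)) μ := by
  have hm : StronglyMeasurable[ℱ t] (fun ω => fderiv ℝ (lyap N s θ) (x t ω - xstar)) :=
    (measurable_fderiv ℝ (lyap N s θ)).stronglyMeasurable.comp_measurable
      (hx.stronglyMeasurable_sub t).measurable
  refine ⟨hm, Integrable.mono' ((hint.add (hx.integrable_sq t)).const_mul (ρ ^ 2 * L / 2))
    ?_ (Filter.Eventually.of_forall fun ω => ?_)⟩
  · exact (ContinuousLinearMap.id ℝ ((ι → ℝ) →L[ℝ] ℝ)).aestronglyMeasurable_comp₂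
      (hm.mono (ℱ.le t)).aestronglyMeasurable (hx.integrable t).aestronglyMeasurable
  · have h1 := h.abs_fderiv_lyap_le hc (x t ω - xstar) (w t ω)
    have hG : 0 < ρ ^ 2 * L := mul_pos (pow_pos hc.rho_pos 2) hc.L_pos
    have h2 := mul_nonneg hG.le (sq_nonneg (p (x t ω - xstar) - p (w t ω)))
    rw [Real.norm_eq_abs, Pi.add_apply]
    linarith

variable [IsProbabilityMeasure μ]

lemma IsBiasedSA.integrable_sub_sq (hx : IsBiasedSA μ ℱ p H xstar x0 η A B ε x w)
    (hγ1 : γ ≤ 1) (hη : ∀ t, 0 ≤ η t)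
    (hH : ∀ y, p (H y - xstar) ≤ γ * p (y - xstar)) (t : ℕ) :
    Integrable (fun ω => p (x t ω - xstar) ^ 2) μ := by
  induction t with
  | zero => simp [hx.init]
  | succ t ih =>
    have hmeas : AEStronglyMeasurable (fun ω => p (x (t + 1) ω - xstar) ^ 2) μ :=
      (((seminorm_continuous p).pow 2).comp_stronglyMeasurable
        ((hx.stronglyMeasurable_sub (t + 1)).mono (ℱ.le _))).aestronglyMeasurable
    refine Integrable.mono' ((ih.const_mul (2 * (1 + 2 * η t) ^ 2)).add
      ((hx.integrable_sq t).const_mul (2 * η t ^ 2))) hmeas (Filter.Eventually.of_forall fun ω => ?_)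
    rw [Real.norm_of_nonneg (by positivity), Pi.add_apply, hx.sub_eq]
    have h1 := map_add_le_add p (x t ω - xstar)
      (η t • ((H (x t ω) - xstar) - (x t ω - xstar) + w t ω))
    rw [map_smul_eq_mul, Real.norm_of_nonneg (hη t)] at h1
    have h2 := map_add_le_add p ((H (x t ω) - xstar) - (x t ω - xstar)) (w t ω)
    have h3 := map_sub_le_add p (H (x t ω) - xstar) (x t ω - xstar)
    have h4 := (hH (x t ω)).trans
      (mul_le_of_le_one_left (apply_nonneg p (x t ω - xstar)) hγ1)
    have h5 := mul_le_mul_of_nonneg_left (h2.trans (add_le_add_left (h3.trans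
      (add_le_add_left h4 _)) _)) (hη t)
    have h6 : p (x t ω - xstar + η t • ((H (x t ω) - xstar) - (x t ω - xstar) + w t ω))
        ≤ (1 + 2 * η t) * p (x t ω - xstar) + η t * p (w t ω) := by linarith
    have h7 := pow_le_pow_left₀ (apply_nonneg p _) h6 2
    nlinarith [sq_nonneg ((1 + 2 * η t) * p (x t ω - xstar) - η t * p (w t ω))]

lemma IsBiasedSA.bias_nonneg (hx : IsBiasedSA μ ℱ p H xstar x0 η A B ε x w) : 0 ≤ ε := by
  obtain ⟨ω, hω⟩ := (hx.bias 0).exists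
  exact (apply_nonneg p _).trans hω

lemma IsBiasedSA.integral_noise_sq_le (hx : IsBiasedSA μ ℱ p H xstar x0 η A B ε x w) (t : ℕ)
    (hint : Integrable (fun ω => p (x t ω - xstar) ^ 2) μ) :
    ∫ ω, p (w t ω) ^ 2 ∂μ ≤ A + B * ∫ ω, p (x t ω - xstar) ^ 2 ∂μ := by
  rw [← integral_condExp (ℱ.le t)]
  refine (integral_mono_ae integrable_condExp
    ((integrable_const A).add (hint.const_mul B)) (hx.second_moment t)).trans (le_of_eq ?_)
  simp only [Pi.add_apply]
  rw [integral_add (integrable_const A) (hint.const_mul B), integral_const_mul]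
  simp

/-- The gradient is `ℱ t`-measurable, so conditioning acts on `w t` alone and leaves its conditional
mean, of `p`-size at most `ε`. -/
lemma IsBiasedSA.integral_fderiv_lyap_le (h : IsSmoothing p N s θ σ)
    (hc : IsConstants p N s θ cl cu L ρ)
    (hx : IsBiasedSA μ ℱ p H xstar x0 η A B ε x w) (t : ℕ)
    (hint : Integrable (fun ω => p (x t ω - xstar) ^ 2) μ) {R : ℝ}
    (hR : ∀ᵐ ω ∂μ, p (x t ω - xstar) * ε ≤ R) :
    ∫ ω, fderiv ℝ (lyap N s θ) (x t ω - xstar) (w t ω) ∂μ ≤ ρ ^ 2 * L * R := by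
  have hG : 0 < ρ ^ 2 * L := mul_pos (pow_pos hc.rho_pos 2) hc.L_pos
  obtain ⟨hm, hi⟩ := hx.integrable_fderiv_lyap h hc t hint
  have hpull := condExp_bilin_of_stronglyMeasurable_left
    (ContinuousLinearMap.id ℝ ((ι → ℝ) →L[ℝ] ℝ)) hm hi (hx.integrable t)
  simp only [ContinuousLinearMap.id_apply] at hpull
  rw [← integral_condExp (ℱ.le t)]
  have hle : μ[fun ω => fderiv ℝ (lyap N s θ) (x t ω - xstar) (w t ω) | ℱ t]
      ≤ᵐ[μ] fun _ => ρ ^ 2 * L * R := by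
    filter_upwards [hpull, hx.bias t, hR] with ω h1 h2 h3
    rw [h1]
    refine (le_abs_self _).trans ((h.abs_fderiv_lyap_le hc _ _).trans ?_)
    rw [mul_assoc]
    refine mul_le_mul_of_nonneg_left (le_trans ?_ h3) hG.le
    exact mul_le_mul_of_nonneg_left h2 (apply_nonneg p _)
  refine (integral_mono_ae integrable_condExp (integrable_const _) hle).trans (le_of_eq ?_)
  simp

/-- One-step recursion for the expected semi-Lyapunov function. -/
lemma IsBiasedSA.integral_lyap_succ_le (h : IsSmoothing p N s θ σ)
    (hc : IsConstants p N s θ cl cu L ρ)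
    (hx : IsBiasedSA μ ℱ p H xstar x0 η A B ε x w)
    (hγ0 : 0 ≤ γ) (hγ1 : γ ≤ 1) (hη : ∀ t, 0 ≤ η t) (hB : 0 ≤ B)
    (hH : ∀ y, p (H y - xstar) ≤ γ * p (y - xstar)) (t : ℕ) {R : ℝ}
    (hR : ∀ᵐ ω ∂μ, p (x t ω - xstar) * ε ≤ R) :
    ∫ ω, lyap N s θ (x (t + 1) ω - xstar) ∂μ ≤
      (1 - 2 * alpha2 γ cl cu * η t + alpha3 B cu L ρ * η t ^ 2)
          * ∫ ω, lyap N s θ (x t ω - xstar) ∂μ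
        + η t * (ρ ^ 2 * L * R) + η t ^ 2 * alpha4 A L ρ := by
  have hG : 0 < ρ ^ 2 * L := mul_pos (pow_pos hc.rho_pos 2) hc.L_pos
  have hint := hx.integrable_sub_sq hγ1 hη hH
  have hM := hx.integrable_lyap h hc t (hint t)
  have hD := (hx.integrable_fderiv_lyap h hc t (hint t)).2
  have hP := hint t
  have hW := hx.integrable_sq t
  have i1 : Integrable (fun ω => (1 - 2 * alpha2 γ cl cu * η t) * lyap N s θ (x t ω - xstar)) μ :=
    hM.const_mul _
  have i2 : Integrable
      (fun ω => η t * fderiv ℝ (lyap N s θ) (x t ω - xstar) (w t ω)) μ := hD.const_mul _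
  have i12 : Integrable (fun ω => (1 - 2 * alpha2 γ cl cu * η t) * lyap N s θ (x t ω - xstar)
      + η t * fderiv ℝ (lyap N s θ) (x t ω - xstar) (w t ω)) μ := i1.add i2
  have i4 : Integrable (fun ω => 4 * p (x t ω - xstar) ^ 2) μ := hP.const_mul 4
  have i3 : Integrable (fun ω => η t ^ 2 * (ρ ^ 2 * L) *
      (4 * p (x t ω - xstar) ^ 2 + p (w t ω) ^ 2)) μ := (i4.add hW).const_mul _
  have h1 : ∫ ω, lyap N s θ (x (t + 1) ω - xstar) ∂μ ≤
      ∫ ω, ((1 - 2 * alpha2 γ cl cu * η t) * lyap N s θ (x t ω - xstar)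
        + η t * fderiv ℝ (lyap N s θ) (x t ω - xstar) (w t ω)
        + η t ^ 2 * (ρ ^ 2 * L) * (4 * p (x t ω - xstar) ^ 2 + p (w t ω) ^ 2)) ∂μ := by
    refine integral_mono (hx.integrable_lyap h hc (t + 1) (hint (t + 1))) (i12.add i3) fun ω => ?_
    simp only
    rw [hx.sub_eq]
    exact h.lyap_step_le hc hγ0 hγ1 (hH _) (hη t)
  rw [integral_add i12 i3, integral_add i1 i2, integral_const_mul, integral_const_mul,
    integral_const_mul, integral_add i4 hW, integral_const_mul] at h1
  have h2 := mul_le_mul_of_nonneg_left (hx.integral_fderiv_lyap_le h hc t hP hR) (hη t)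
  have h3 := hx.integral_noise_sq_le t hP
  have h4 : ∫ ω, p (x t ω - xstar) ^ 2 ∂μ ≤ 2 * cu * ∫ ω, lyap N s θ (x t ω - xstar) ∂μ := by
    rw [← integral_const_mul]
    exact integral_mono hP (hM.const_mul _) fun ω => by linarith [hc.upper (x t ω - xstar)]
  have h5 := mul_le_mul_of_nonneg_left h4 (by positivity : 0 ≤ 4 + B)
  have h6 : 4 * ∫ ω, p (x t ω - xstar) ^ 2 ∂μ + ∫ ω, p (w t ω) ^ 2 ∂μ ≤
      (4 + B) * (2 * cu * ∫ ω, lyap N s θ (x t ω - xstar) ∂μ) + A := by linarith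
  have h7 := mul_le_mul_of_nonneg_left h6 (mul_nonneg (sq_nonneg (η t)) hG.le)
  rw [alpha3, alpha4]
  linarith

/-- The finite-time bound. -/
lemma IsBiasedSA.integral_sub_sq_le (h : IsSmoothing p N s θ σ)
    (hc : IsConstants p N s θ cl cu L ρ) {xsup : ℝ} (hα : 0 < alpha2 γ cl cu)
    (hx : IsBiasedSA μ ℱ p H xstar x0
      (fun t => 1 / (alpha2 γ cl cu * ((t : ℝ) + offset γ B cl cu L ρ))) A B ε x w)
    (hγ0 : 0 ≤ γ) (hγ1 : γ ≤ 1) (hA : 0 ≤ A) (hB : 0 ≤ B)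
    (hH : ∀ y, p (H y - xstar) ≤ γ * p (y - xstar))
    (hsup : ε ≠ 0 → p xstar ≤ xsup ∧ ∀ t, ∀ᵐ ω ∂μ, p (x t ω) ≤ xsup) {T : ℕ} (hT : 1 ≤ T) :
    Integrable (fun ω => p (x T ω - xstar) ^ 2) μ ∧
      ∫ ω, p (x T ω - xstar) ^ 2 ∂μ ≤
        4 * offset γ B cl cu L ρ ^ 2 * cu / (((T : ℝ) + offset γ B cl cu L ρ) ^ 2 * cl)
            * p (x0 - xstar) ^ 2
          + 8 * alpha4 A L ρ * cu / (((T : ℝ) + offset γ B cl cu L ρ) * alpha2 γ cl cu ^ 2)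
          + 2 * cu * (2 * (ρ ^ 2 * L) * xsup)
              * (1 / offset γ B cl cu L ρ
                + Real.log (((T : ℝ) - 1 + offset γ B cl cu L ρ) / offset γ B cl cu L ρ))
              * ε / alpha2 γ cl cu := by
  have hcl := hc.cl_pos
  have hcu := hc.cu_pos
  have hG : 0 < ρ ^ 2 * L := mul_pos (pow_pos hc.rho_pos 2) hc.L_pos
  have hε := hx.bias_nonneg
  -- When `ε = 0` the product vanishes whatever `xsup` is, so no boundedness is needed.
  have hR0 : 0 ≤ 2 * xsup * ε := by
    rcases eq_or_ne ε 0 with rfl | h0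
    · simp
    · have := (apply_nonneg p xstar).trans (hsup h0).1
      positivity
  have hR : ∀ t, ∀ᵐ ω ∂μ, p (x t ω - xstar) * ε ≤ 2 * xsup * ε := by
    intro t
    rcases eq_or_ne ε 0 with rfl | h0
    · simp
    · filter_upwards [(hsup h0).2 t] with ω hω
      refine mul_le_mul_of_nonneg_right ?_ hε
      linarith [map_sub_le_add p (x t ω) xstar, (hsup h0).1]
  have hK : 3 ≤ offset γ B cl cu L ρ := le_max_right _ _
  have hK3 : alpha3 B cu L ρ / alpha2 γ cl cu ^ 2 ≤ offset γ B cl cu L ρ := le_max_left _ _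
  have hα4 : 0 ≤ alpha4 A L ρ := by rw [alpha4, mul_assoc]; positivity
  set K := offset γ B cl cu L ρ
  set α := alpha2 γ cl cu with hαdef
  have hη : ∀ t : ℕ, 0 ≤ 1 / (α * ((t : ℝ) + K)) := fun t => by positivity
  have hint := hx.integrable_sub_sq hγ1 hη hH
  refine ⟨hint T, ?_⟩
  set m : ℕ → ℝ := fun t => ∫ ω, lyap N s θ (x t ω - xstar) ∂μ with hm
  have hm0 : ∀ t, 0 ≤ m t := fun t => integral_nonneg fun ω => h.lyap_nonneg _
  have hrec : ∀ t : ℕ, m (t + 1) ≤ (1 - 2 / ((t : ℝ) + K) + K / ((t : ℝ) + K) ^ 2) * m t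
      + (ρ ^ 2 * L * (2 * xsup * ε) / α) / ((t : ℝ) + K)
      + (alpha4 A L ρ / α ^ 2) / ((t : ℝ) + K) ^ 2 := by
    intro t
    have ht : (0 : ℝ) < t + K := by positivity
    refine (hx.integral_lyap_succ_le h hc hγ0 hγ1 hη hB hH t (hR t)).trans ?_
    rw [← hαdef]
    have e1 : 2 * α * (1 / (α * ((t : ℝ) + K))) = 2 / ((t : ℝ) + K) := by field_simp
    have e2 : alpha3 B cu L ρ * (1 / (α * ((t : ℝ) + K))) ^ 2
        = alpha3 B cu L ρ / α ^ 2 / ((t : ℝ) + K) ^ 2 := by field_simp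
    have e3 : 1 / (α * ((t : ℝ) + K)) * (ρ ^ 2 * L * (2 * xsup * ε))
        = (ρ ^ 2 * L * (2 * xsup * ε) / α) / ((t : ℝ) + K) := by field_simp
    have e4 : (1 / (α * ((t : ℝ) + K))) ^ 2 * alpha4 A L ρ
        = (alpha4 A L ρ / α ^ 2) / ((t : ℝ) + K) ^ 2 := by field_simp
    rw [e1, e2, e3, e4]
    -- Here $\alpha_3/\alpha_2^2$ is replaced by the larger $K$.
    gcongr
    exact hm0 t
  have hD : 0 ≤ ρ ^ 2 * L * (2 * xsup * ε) / α := by positivity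
  have hF : 0 ≤ alpha4 A L ρ / α ^ 2 := by positivity
  have hmT := le_of_stepsize_recursion hK hm0 hD hF hrec T
  have hm_init : m 0 ≤ p (x0 - xstar) ^ 2 / (2 * cl) := by
    have e : m 0 = lyap N s θ (x0 - xstar) := by simp [hm, hx.init]
    rw [e, le_div_iff₀ (by positivity)]
    linarith [hc.lower (x0 - xstar)]
  have hsum : ∑ t ∈ Finset.range T, 1 / ((t : ℝ) + K)
      ≤ 1 / K + Real.log (((T : ℝ) - 1 + K) / K) := by
    -- The sum ends at $T-1$, whence the $T-1+K$ in the logarithm.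
    obtain ⟨T, rfl⟩ := Nat.exists_eq_add_of_le' hT
    have := sum_inv_add_le (by linarith : 0 < K) T
    push_cast
    rwa [add_sub_cancel_right]
  have hlast : ∫ ω, p (x T ω - xstar) ^ 2 ∂μ ≤ 2 * cu * m T := by
    rw [hm, ← integral_const_mul]
    exact integral_mono (hint T) ((hx.integrable_lyap h hc T (hint T)).const_mul _)
      fun ω => by linarith [hc.upper (x T ω - xstar)]
  have hT0 : (0 : ℝ) ≤ T := T.cast_nonneg
  have hK0 : 0 < K := by linarith
  have b1 : 4 * K ^ 2 / ((T : ℝ) + 2 * K) ^ 2 * m 0 ≤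
      4 * K ^ 2 / ((T : ℝ) + K) ^ 2 * (p (x0 - xstar) ^ 2 / (2 * cl)) := by
    gcongr
    · exact hm0 0
    · linarith
  have b2 : 4 * (T : ℝ) / ((T : ℝ) + K) ^ 2 ≤ 4 / ((T : ℝ) + K) := by
    rw [div_le_div_iff₀ (by positivity) (by positivity)]
    nlinarith
  have b2' := mul_le_mul_of_nonneg_left b2 hF
  have b3 := mul_le_mul_of_nonneg_left hsum hD
  have b4 := mul_le_mul_of_nonneg_left (hmT.trans (add_le_add (add_le_add b1 b2') b3))
    (by positivity : 0 ≤ 2 * cu)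
  refine hlast.trans (b4.trans (le_of_eq ?_))
  generalize Real.log (((T : ℝ) - 1 + K) / K) = ℓ
  field_simp
  ring

end Stochastic

end BiasedSA

theorem theorem3 {ι : Type*} [Fintype ι] (p : Seminorm ℝ (ι → ℝ))
    (hp : ∀ x, p x = 0 ↔ ∃ c : ℝ, x = c • (1 : ι → ℝ))
    (γ : ℝ) (hγ0 : 0 < γ) (hγ1 : γ < 1) :
    -- every admissible smoothing has such constants, with `L = σ / θ`
    (∀ (N s : Seminorm ℝ (ι → ℝ)) (θ σ : ℝ), BiasedSA.IsSmoothing p N s θ σ →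
      ∃ cl cu ρ : ℝ, BiasedSA.IsConstants p N s θ cl cu (σ / θ) ρ) ∧
    -- some admissible smoothing has `α₂ ≥ (1 - γ) / 2`
    (∃ (N s : Seminorm ℝ (ι → ℝ)) (θ σ cl cu L ρ : ℝ),
      BiasedSA.IsSmoothing p N s θ σ ∧ BiasedSA.IsConstants p N s θ cl cu L ρ ∧
      (1 - γ) / 2 ≤ BiasedSA.alpha2 γ cl cu) ∧
    -- the finite-time bound, for all smoothings and constants with `α₂ > 0`
    (∀ (N s : Seminorm ℝ (ι → ℝ)) (θ σ cl cu L ρ : ℝ),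
      BiasedSA.IsSmoothing p N s θ σ → BiasedSA.IsConstants p N s θ cl cu L ρ →
      0 < BiasedSA.alpha2 γ cl cu →
      ∀ (Ω : Type*) [mΩ : MeasurableSpace Ω] (μ : Measure Ω) [IsProbabilityMeasure μ]
        (ℱ : Filtration ℕ mΩ) (H : (ι → ℝ) → (ι → ℝ)) (xstar x0 : ι → ℝ)
        (A B ε xsup : ℝ) (x w : ℕ → Ω → (ι → ℝ)),
      (∀ y z, p (H y - H z) ≤ γ * p (y - z)) →
      (∃ c : ℝ, H xstar - xstar = c • (1 : ι → ℝ)) →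
      0 ≤ A → 0 ≤ B →
      BiasedSA.IsBiasedSA μ ℱ p H xstar x0
        (fun t => 1 / (BiasedSA.alpha2 γ cl cu * ((t : ℝ) + BiasedSA.offset γ B cl cu L ρ)))
        A B ε x w →
      (ε ≠ 0 → p xstar ≤ xsup ∧ ∀ t, ∀ᵐ ω ∂μ, p (x t ω) ≤ xsup) →
      ∀ T : ℕ, 1 ≤ T →
        Integrable (fun ω => p (x T ω - xstar) ^ 2) μ ∧
        ∫ ω, p (x T ω - xstar) ^ 2 ∂μ ≤
          4 * BiasedSA.offset γ B cl cu L ρ ^ 2 * cu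
              / (((T : ℝ) + BiasedSA.offset γ B cl cu L ρ) ^ 2 * cl) * p (x0 - xstar) ^ 2
          + 8 * BiasedSA.alpha4 A L ρ * cu
              / (((T : ℝ) + BiasedSA.offset γ B cl cu L ρ) * BiasedSA.alpha2 γ cl cu ^ 2)
          + 2 * cu * (2 * (ρ ^ 2 * L) * xsup)
              * (1 / BiasedSA.offset γ B cl cu L ρ
                + Real.log (((T : ℝ) - 1 + BiasedSA.offset γ B cl cu L ρ)
                    / BiasedSA.offset γ B cl cu L ρ))
              * ε / BiasedSA.alpha2 γ cl cu) := by
  refine ⟨fun N s θ σ h => h.exists_isConstants,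
    BiasedSA.exists_isSmoothing_alpha2_ge hp hγ0 hγ1, ?_⟩
  intro N s θ σ cl cu L ρ h hc hα Ω mΩ μ _ ℱ H xstar x0 A B ε xsup x w hH hfix hA hB hx hsup T hT
  exact hx.integral_sub_sq_le h hc hα hγ0.le hγ1.le hA hB
    (BiasedSA.seminorm_sub_fixed_le hp hH hfix) hsup hT
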